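/- Let $T>0$, let $\omega\subset\Omega\subset\mathbb{R}^n$ be measurable sets (for instance $\Omega$ a bounded Lipschitz domain and $\omega$ an observation domain), and let $W$ be a real Hilbert space with a continuous linear embedding $W\hookrightarrow L^2(0,T;L^2(\Omega))$. Let $S\colon L^2(0,T;\mathbb{R}^2)\to W$ be continuous and affine, with linear part $S_0$, i.e. $Su=S_0u+S(0)$; through the embedding and restriction to $\omega$, regard $S$ and $S_0$ also as maps into $L^2(0,T;L^2(\omega))$, and let $S_0^*\colon L^2(0,T;L^2(\omega))\to L^2(0,T;\mathbb{R}^2)$ be the adjoint of $S_0$. Let $y^d\in L^2(0,T;L^2(\omega))$ and $\beta>\alpha>0$, and consider the problem $$\min_{u\in\mathcal{U}} J(u),\qquad J(u)=\tfrac12\|Su-y^d\|_{L^2(0,T;L^2(\omega))}^2+\tfrac\alpha2\|u\|_{L^2(0,T;\mathbb{R}^2)}^2+\tfrac\varepsilon2\|u_t\|_{L^2(0,T;\mathbb{R}^2)}^2+\beta\int_0^T|u_1(t)u_2(t)|\,dt,$$ where either (i) $\mathcal{U}=H^1(0,T;\mathbb{R}^2)$ and $\varepsilon>0$, or (ii)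 $\mathcal{U}$ is a finite-dimensional subspace of $L^2(0,T;\mathbb{R}^2)$ and $\varepsilon=0$ (the $u_t$ term being absent). For measurable $v$ on $(0,T)$ let $\operatorname{sign}(v)\subset L^\infty(0,T)$ be the set of all $q\in L^\infty(0,T)$ with, for almost every $t$, $q(t)=1$ if $v(t)>0$, $q(t)=-1$ if $v(t)<0$, and $q(t)\in[-1,1]$ if $v(t)=0$. Then every local minimizer $\bar u\in\mathcal{U}$ of $J$ (with respect to the norm of $\mathcal{U}$) satisfies $$0\in S_0^*(S\bar u-y^d)+\alpha\bar u-\varepsilon\bar u_{tt}+\beta\operatorname{sign}(\bar u_1\bar u_2)\begin{pmatrix}\bar u_2\\\bar u_1\end{pmatrix},$$ where the right-hand side is a subset of the dual space $\mathcal{U}^*$: a function $w\in L^2(0,T;\mathbb{R}^2)$ acts on $v\in\mathcal{U}$ by $(w,v)_{L^2(0,T;\mathbb{R}^2)}$, and in case (i) $-\bar u_{tt}$ acts by $v\mapsto(\bar u_t,v_t)_{L^2(0,T;\mathbb{R}^2)}$. In other words, there is $q\in\operatorname{sign}(\bar u_1\bar u_2)$ such that for all $v\in\mathcal{U}$ $$\bigl(S_0^*(S\bar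 u-y^d)+\alpha\bar u,v\bigr)_{L^2}+\varepsilon(\bar u_t,v_t)_{L^2}+\beta\int_0^T q\,(\bar u_2v_1+\bar u_1v_2)\,dt=0 .$$ -/

import Mathlib

open MeasureTheory Set
open scoped ENNReal

namespace SwitchingControl

noncomputable section

/-- Lebesgue measure on the time interval `(0, T)`. -/
abbrev timeMeasure (T : ℝ) : Measure ℝ := volume.restrict (Ioo 0 T)

/-- `L²(0,T;ℝ²)`, where `ℝ²` carries the Euclidean norm. -/
abbrev ControlL2 (T : ℝ) : Type := Lp (EuclideanSpace ℝ (Fin 2)) 2 (timeMeasure T)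

/-- The Bochner space `L²(0,T;L²(Ω))`. -/
abbrev StateL2 (T : ℝ) {n : ℕ} (Ω : Set (EuclideanSpace ℝ (Fin n))) : Type :=
  Lp (Lp ℝ 2 (volume.restrict Ω)) 2 (timeMeasure T)

/-- The Bochner space `L²(0,T;L²(ω))` for an observation domain `ω ⊆ Ω`. (For `ω ⊆ Ω`, restricting
Lebesgue measure to `Ω` and then to `ω` is the same as restricting it to `ω`.) -/
abbrev ObsL2 (T : ℝ) {n : ℕ} (Ω ω : Set (EuclideanSpace ℝ (Fin n))) : Type :=
  Lp (Lp ℝ 2 ((volume.restrict Ω).restrict ω)) 2 (timeMeasure T)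

/-- Restriction to the observation domain, `L²(0,T;L²(Ω)) → L²(0,T;L²(ω))`: at (almost) every time
`t` the function `y(t) ∈ L²(Ω)` is replaced by its restriction to `ω`. -/
def observe (T : ℝ) {n : ℕ} (Ω ω : Set (EuclideanSpace ℝ (Fin n))) :
    StateL2 T Ω →L[ℝ] ObsL2 T Ω ω :=
  (LpToLpRestrictCLM (EuclideanSpace ℝ (Fin n)) ℝ ℝ (volume.restrict Ω) 2 ω).compLpL 2
    (timeMeasure T)

/-- `v` is the weak derivative of `u` on `(0,T)`: `∫ φ' u = - ∫ φ v` for all test functions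
`φ ∈ C_c^∞(0,T)`. -/
def IsWeakDeriv {T : ℝ} (u v : ControlL2 T) : Prop :=
  ∀ φ : ℝ → ℝ, ContDiff ℝ ((⊤ : ℕ∞) : WithTop ℕ∞) φ → HasCompactSupport φ → tsupport φ ⊆ Ioo 0 T →
    ∫ t, deriv φ t • u t ∂(timeMeasure T) = - ∫ t, φ t • v t ∂(timeMeasure T)

theorem integrable_smul_control {T : ℝ} (u : ControlL2 T) {ψ : ℝ → ℝ} (hψ : Continuous ψ)
    (hc : HasCompactSupport ψ) : Integrable (fun t => ψ t • u t) (timeMeasure T) := by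
  obtain ⟨C, hC⟩ := hc.exists_bound_of_continuous hψ
  exact ((Lp.memLp u).integrable (by norm_num)).bdd_smul C hψ.aestronglyMeasurable
    (Filter.Eventually.of_forall hC)

/-- The Sobolev space `H¹(0,T;ℝ²)`, realised as the space of pairs `(u, u_t)` of a function
`u ∈ L²(0,T;ℝ²)` and its weak derivative `u_t ∈ L²(0,T;ℝ²)`. The norm inherited from the Hilbert
space `L² × L²` is the usual one, `‖u‖² = ‖u‖²_{L²} + ‖u_t‖²_{L²}`. -/
def H1 (T : ℝ) : Submodule ℝ (WithLp 2 (ControlL2 T × ControlL2 T)) where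
  carrier := {w | IsWeakDeriv w.fst w.snd}
  zero_mem' := by
    intro φ _ _ _
    have h0 : ((0 : ControlL2 T) : ℝ → EuclideanSpace ℝ (Fin 2)) =ᵐ[timeMeasure T] 0 :=
      Lp.coeFn_zero _ _ _
    have h1 : ∫ t, deriv φ t • (0 : ControlL2 T) t ∂(timeMeasure T) = 0 := by
      refine integral_eq_zero_of_ae ?_
      filter_upwards [h0] with t ht
      rw [ht, Pi.zero_apply, smul_zero]
    have h2 : ∫ t, φ t • (0 : ControlL2 T) t ∂(timeMeasure T) = 0 := by
      refine integral_eq_zero_of_ae ?_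
      filter_upwards [h0] with t ht
      rw [ht, Pi.zero_apply, smul_zero]
    change ∫ t, deriv φ t • (0 : ControlL2 T) t ∂(timeMeasure T)
      = - ∫ t, φ t • (0 : ControlL2 T) t ∂(timeMeasure T)
    rw [h1, h2, neg_zero]
  add_mem' := by
    intro a b ha hb φ hφ hc hs
    have key : ∀ (ψ : ℝ → ℝ), Continuous ψ → HasCompactSupport ψ → ∀ x y : ControlL2 T,
        ∫ t, ψ t • (x + y) t ∂(timeMeasure T)
          = ∫ t, ψ t • x t ∂(timeMeasure T) + ∫ t, ψ t • y t ∂(timeMeasure T) := by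
      intro ψ h1 h2 x y
      rw [← integral_add (integrable_smul_control x h1 h2) (integrable_smul_control y h1 h2)]
      refine integral_congr_ae ?_
      filter_upwards [Lp.coeFn_add x y] with t ht
      rw [ht, Pi.add_apply, smul_add]
    have hd : Continuous (deriv φ) := hφ.continuous_deriv (by simp)
    change ∫ t, deriv φ t • (a.fst + b.fst) t ∂(timeMeasure T)
      = - ∫ t, φ t • (a.snd + b.snd) t ∂(timeMeasure T)
    rw [key _ hd hc.deriv, key _ hφ.continuous hc, ha φ hφ hc hs, hb φ hφ hc hs, neg_add]
  smul_mem' := by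
    intro c a ha φ hφ hc hs
    have key : ∀ (ψ : ℝ → ℝ) (x : ControlL2 T),
        ∫ t, ψ t • (c • x) t ∂(timeMeasure T) = c • ∫ t, ψ t • x t ∂(timeMeasure T) := by
      intro ψ x
      rw [← integral_smul]
      refine integral_congr_ae ?_
      filter_upwards [Lp.coeFn_smul c x] with t ht
      rw [ht, Pi.smul_apply, smul_comm]
    change ∫ t, deriv φ t • (c • a.fst) t ∂(timeMeasure T)
      = - ∫ t, φ t • (c • a.snd) t ∂(timeMeasure T)
    rw [key, key, ha φ hφ hc hs, smul_neg]

/-- The embedding `H¹(0,T;ℝ²) → L²(0,T;ℝ²)`. -/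
def H1.toL2 (T : ℝ) : H1 T →L[ℝ] ControlL2 T :=
  (WithLp.fstL 2 ℝ (ControlL2 T) (ControlL2 T)).comp (H1 T).subtypeL

/-- The weak derivative `u ↦ u_t`, `H¹(0,T;ℝ²) → L²(0,T;ℝ²)`. -/
def H1.weakDeriv (T : ℝ) : H1 T →L[ℝ] ControlL2 T :=
  (WithLp.sndL 2 ℝ (ControlL2 T) (ControlL2 T)).comp (H1 T).subtypeL

/-- For `u ∈ H¹(0,T;ℝ²)`, the element `-u_tt` of `H¹(0,T;ℝ²)^*`, i.e. `v ↦ (u_t, v_t)_{L²}`. -/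
def negSecondDeriv {T : ℝ} (u : H1 T) : StrongDual ℝ (H1 T) :=
  (innerSL ℝ (H1.weakDeriv T u)).comp (H1.weakDeriv T)

/-- A function `w ∈ L²(0,T;ℝ²)` as an element of the dual of a space `U` of controls that is
embedded in `L²(0,T;ℝ²)` by `j`, i.e. `v ↦ (w, v)_{L²}`. -/
def l2Functional {T : ℝ} {U : Type*} [NormedAddCommGroup U] [NormedSpace ℝ U]
    (j : U →L[ℝ] ControlL2 T) (w : ControlL2 T) : StrongDual ℝ U :=
  (innerSL ℝ w).comp j

/-- The switching penalty `∫_0^T |u₁(t) u₂(t)| dt`. -/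
def switchingPenalty {T : ℝ} (u : ControlL2 T) : ℝ :=
  ∫ t, |u t 0 * u t 1| ∂(timeMeasure T)

/-- The set-valued sign on `ℝ`. -/
def setSign (r : ℝ) : Set ℝ :=
  if 0 < r then {1} else if r < 0 then {-1} else Icc (-1) 1

/-- The set `sign(u₁u₂) ⊆ L^∞(0,T)` of all measurable selections of `t ↦ sign(u₁(t)u₂(t))`. -/
def signProduct {T : ℝ} (u : ControlL2 T) : Set (Lp ℝ ∞ (timeMeasure T)) :=
  {q | ∀ᵐ t ∂(timeMeasure T), q t ∈ setSign (u t 0 * u t 1)}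

/-- The exchange of components `(u₁, u₂) ↦ (u₂, u₁)` on `L²(0,T;ℝ²)`. -/
def swapComponents {T : ℝ} (u : ControlL2 T) : ControlL2 T :=
  ((LinearIsometryEquiv.piLpCongrLeft 2 ℝ ℝ
    (Equiv.swap (0 : Fin 2) 1)).toContinuousLinearEquiv :
      EuclideanSpace ℝ (Fin 2) →L[ℝ] EuclideanSpace ℝ (Fin 2)).compLp u

section Problem

variable {T : ℝ} {n : ℕ} {Ω : Set (EuclideanSpace ℝ (Fin n))} (ω : Set (EuclideanSpace ℝ (Fin n)))
variable {W : Type*} [NormedAddCommGroup W] [InnerProductSpace ℝ W]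
variable (ι : W →L[ℝ] StateL2 T Ω) (S : ControlL2 T →ᴬ[ℝ] W) (yd : ObsL2 T Ω ω)

/-- The residual `S u - y^d` in `L²(0,T;L²(ω))`. -/
def residual (u : ControlL2 T) : ObsL2 T Ω ω := observe T Ω ω (ι (S u)) - yd

/-- The linear control-to-observation operator `S₀ : L²(0,T;ℝ²) → L²(0,T;L²(ω))`, given by the
linear part of the affine control-to-state map `S`. -/
def linearObsOp : ControlL2 T →L[ℝ] ObsL2 T Ω ω :=
  (observe T Ω ω).comp (ι.comp S.contLinear)

/-- The function `S₀^*(S u - y^d)` in `L²(0,T;ℝ²)`. -/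
def adjointResidual (u : ControlL2 T) : ControlL2 T :=
  ContinuousLinearMap.adjoint (linearObsOp ω ι S) (residual ω ι S yd u)

/-- The cost functional on `H¹(0,T;ℝ²)`. -/
def costH1 (α β ε : ℝ) (u : H1 T) : ℝ :=
  1 / 2 * ‖residual ω ι S yd (H1.toL2 T u)‖ ^ 2 + α / 2 * ‖H1.toL2 T u‖ ^ 2
    + ε / 2 * ‖H1.weakDeriv T u‖ ^ 2 + β * switchingPenalty (H1.toL2 T u)

/-- The cost functional (with `ε = 0`) on a subspace `U` of `L²(0,T;ℝ²)`. -/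
def costSubspace (α β : ℝ) (U : Submodule ℝ (ControlL2 T)) (u : U) : ℝ :=
  1 / 2 * ‖residual ω ι S yd u‖ ^ 2 + α / 2 * ‖(u : ControlL2 T)‖ ^ 2
    + β * switchingPenalty (u : ControlL2 T)

/-- The set `S₀^*(S u - y^d) + α u - ε u_tt + β sign(u₁u₂) (u₂, u₁)` in `H¹(0,T;ℝ²)^*`. -/
def optimalitySetH1 (α β ε : ℝ) (u : H1 T) : Set (StrongDual ℝ (H1 T)) :=
  {ξ | ∃ q ∈ signProduct (H1.toL2 T u),
    ξ = l2Functional (H1.toL2 T) (adjointResidual ω ι S yd (H1.toL2 T u))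
      + α • l2Functional (H1.toL2 T) (H1.toL2 T u)
      + ε • negSecondDeriv u
      + β • l2Functional (H1.toL2 T) (q • swapComponents (H1.toL2 T u))}

/-- The set `S₀^*(S u - y^d) + α u + β sign(u₁u₂) (u₂, u₁)` in the dual of a subspace `U` of
`L²(0,T;ℝ²)`. -/
def optimalitySetSubspace (α β : ℝ) (U : Submodule ℝ (ControlL2 T)) (u : U) :
    Set (StrongDual ℝ U) :=
  {ξ | ∃ q ∈ signProduct (u : ControlL2 T),
    ξ = l2Functional U.subtypeL (adjointResidual ω ι S yd u)
      + α • l2Functional U.subtypeL (u : ControlL2 T)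
      + β • l2Functional U.subtypeL (q • swapComponents (u : ControlL2 T))}

end Problem

end

end SwitchingControl

/-! The cost is a Fréchet differentiable functional `A` plus `β` times the switching penalty, which
is neither convex nor smooth but has one-sided directional derivatives. In direction `v` the
derivative is `∫ max (lo * g) (hi * g)`, where `g = u₂v₁ + u₁v₂` depends linearly on `v` and `[lo,
hi]` is the pointwise sign set of `u₁u₂`. It is therefore sublinear in `g ∈ L¹`.

At a local minimizer, `-β⁻¹ A'` is dominated by this sublinear functional of `g`. Hahn-Banach
(`exists_mem_Icc_repr_comp`) extends it from the range of `v ↦ g` to all of `L¹`. A functional on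
`L¹` with this bound is integration against some `q ∈ [lo, hi]` (`exists_mem_Icc_repr`), and this
`q` is the multiplier. The control space enters only through its continuous linear map `j` into
`L²`, so `exists_sign_of_isLocalMin` serves both cases. -/

namespace SwitchingControl

open Filter Topology

/-! ### Dominated functionals on `L¹` -/

section Duality

variable {α : Type*} [MeasurableSpace α] {μ : Measure α}

theorem abs_max_mul_le {a b x : ℝ} (ha : |a| ≤ 1) (hb : |b| ≤ 1) : |max (a * x) (b * x)| ≤ |x| := by
  have h1 : |a * x| ≤ |x| := by
    rw [abs_mul]; exact mul_le_of_le_one_left (abs_nonneg x) ha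
  have h2 : |b * x| ≤ |x| := by
    rw [abs_mul]; exact mul_le_of_le_one_left (abs_nonneg x) hb
  exact abs_max_le_max_abs_abs.trans (max_le h1 h2)

theorem integrable_max_mul {lo hi g : α → ℝ} (hlo : Measurable lo) (hhi : Measurable hi)
    (hlo1 : ∀ x, |lo x| ≤ 1) (hhi1 : ∀ x, |hi x| ≤ 1) (hg : Integrable g μ) :
    Integrable (fun x => max (lo x * g x) (hi x * g x)) μ := by
  refine hg.mono ((hlo.aestronglyMeasurable.mul hg.1).sup (hhi.aestronglyMeasurable.mul hg.1)) ?_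
  exact .of_forall fun x => abs_max_mul_le (hlo1 x) (hhi1 x)

/-- A linear functional on `L¹` of a finite measure that is dominated by
`g ↦ ∫ max (lo * g) (hi * g)` is the integral against a function with values in `[lo, hi]`. -/
theorem exists_mem_Icc_repr [IsFiniteMeasure μ] {lo hi : α → ℝ} (hlo : Measurable lo) (hhi : Measurable hi)
    (hlo1 : ∀ x, |lo x| ≤ 1) (hhi1 : ∀ x, |hi x| ≤ 1) (hlh : ∀ x, lo x ≤ hi x)
    (F : Lp ℝ 1 μ →ₗ[ℝ] ℝ)
    (hF : ∀ g, F g ≤ ∫ x, max (lo x * g x) (hi x * g x) ∂μ) :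
    ∃ q : Lp ℝ ∞ μ, (∀ᵐ x ∂μ, q x ∈ Icc (lo x) (hi x)) ∧ ∀ g, F g = ∫ x, q x * g x ∂μ := by
  have hle : ∀ g, F g ≤ ‖g‖ := fun g => by
    refine (hF g).trans ?_
    rw [L1.norm_eq_integral_norm]
    exact integral_mono (integrable_max_mul hlo hhi hlo1 hhi1 (L1.integrable_coeFn g))
      (L1.integrable_coeFn g).norm
      fun x => (le_abs_self _).trans (abs_max_mul_le (hlo1 x) (hhi1 x))
  let Fc : StrongDual ℝ (Lp ℝ 1 μ) := F.mkContinuous 1 fun g => by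
    rw [one_mul, Real.norm_eq_abs, abs_le]
    have := hle (-g)
    rw [map_neg, norm_neg] at this
    exact ⟨by linarith, hle g⟩
  -- On a finite measure space `L² ⊆ L¹`, by Hölder against the constant `1`. Riesz representation
  -- in `L²` then supplies the density `p`.
  let incl : Lp ℝ 2 μ →L[ℝ] Lp ℝ 1 μ :=
    (ContinuousLinearMap.mul ℝ ℝ).holderL μ 2 2 1 (Lp.const 2 μ (1 : ℝ))
  have hincl : ∀ f, incl f =ᵐ[μ] f := fun f => by
    have h1 := ContinuousLinearMap.coeFn_holder (r := 1) (ContinuousLinearMap.mul ℝ ℝ)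
      (Lp.const 2 μ (1 : ℝ)) f
    filter_upwards [h1, Lp.coeFn_const (p := 2) (μ := μ) (1 : ℝ)] with x hx h2
    refine hx.trans ?_
    rw [h2]; simp
  let p : Lp ℝ 2 μ := (InnerProductSpace.toDual ℝ (Lp ℝ 2 μ)).symm (Fc.comp incl)
  have hp : ∀ f : Lp ℝ 2 μ, F (incl f) = ∫ x, p x * f x ∂μ := fun f => by
    have : inner ℝ p f = Fc (incl f) := by
      simp only [p, InnerProductSpace.toDual_symm_apply, ContinuousLinearMap.comp_apply]
    rw [L2.inner_def] at this
    change Fc (incl f) = _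
    rw [← this]
    refine integral_congr_ae (.of_forall fun x => ?_)
    simp [mul_comm]
  have hind : ∀ (c : ℝ) {s : Set α} (hs : MeasurableSet s),
      F (indicatorConstLp 1 hs (measure_ne_top μ s) c) = c * ∫ x in s, p x ∂μ := by
    intro c s hs
    have h2 := indicatorConstLp_coeFn (p := 2) (hs := hs) (hμs := measure_ne_top μ s) (c := c)
    have h1 := indicatorConstLp_coeFn (p := 1) (hs := hs) (hμs := measure_ne_top μ s) (c := c)
    have : incl (indicatorConstLp 2 hs (measure_ne_top μ s) c)
        = indicatorConstLp 1 hs (measure_ne_top μ s) c := by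
      refine Lp.ext ?_
      filter_upwards [hincl (indicatorConstLp 2 hs (measure_ne_top μ s) c), h1, h2] with x a b d
      rw [a, b, d]
    rw [← this, hp, ← integral_indicator hs, ← integral_const_mul]
    refine integral_congr_ae ?_
    filter_upwards [h2] with x hx
    rw [hx]
    by_cases hxs : x ∈ s <;> simp [hxs, mul_comm]
  have hpi : Integrable p μ := (Lp.memLp p).integrable (by norm_num)
  have hbdd : ∀ {r : α → ℝ}, Measurable r → (∀ x, |r x| ≤ 1) → Integrable r μ := fun hr h1 =>
    Integrable.of_bound hr.aestronglyMeasurable 1 (.of_forall h1)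
  -- Testing the domination on `c` times an indicator: `c = 1` yields `p ≤ hi`, and `c = -1` yields
  -- `lo ≤ p` because `max (-lo) (-hi) = -lo`.
  have hset : ∀ (c : ℝ) {s : Set α} (hs : MeasurableSet s),
      c * ∫ x in s, p x ∂μ ≤ ∫ x in s, max (lo x * c) (hi x * c) ∂μ := by
    intro c s hs
    rw [← hind c hs, ← integral_indicator hs]
    refine (hF _).trans_eq (integral_congr_ae ?_)
    filter_upwards [indicatorConstLp_coeFn (p := 1) (hs := hs) (hμs := measure_ne_top μ s)
      (c := c)] with x hx
    rw [hx]
    by_cases hxs : x ∈ s <;> simp [hxs]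
  have hph : p ≤ᵐ[μ] hi := by
    refine ae_le_of_forall_setIntegral_le hpi (hbdd hhi hhi1) fun s hs _ => ?_
    simpa [hlh] using hset 1 hs
  have hpl : lo ≤ᵐ[μ] p := by
    refine ae_le_of_forall_setIntegral_le (hbdd hlo hlo1) hpi fun s hs _ => ?_
    have := hset (-1) hs
    simp only [mul_neg, mul_one, neg_mul, one_mul, max_neg_neg, min_eq_left (hlh _),
      integral_neg] at this
    linarith
  have hpinf : MemLp p ∞ μ := by
    refine memLp_top_of_bound (Lp.aestronglyMeasurable p) 1 ?_
    filter_upwards [hph, hpl] with x h1 h2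
    rw [Real.norm_eq_abs, abs_le]
    exact ⟨(neg_le_of_abs_le (hlo1 x)).trans h2, h1.trans (le_of_abs_le (hhi1 x))⟩
  let q : Lp ℝ ∞ μ := hpinf.toLp p
  have hqp : q =ᵐ[μ] p := hpinf.coeFn_toLp
  refine ⟨q, ?_, fun g => ?_⟩
  · filter_upwards [hqp, hph, hpl] with x h h1 h2
    rw [h]
    exact ⟨h2, h1⟩
  · have hpair : ∀ g : Lp ℝ 1 μ, (ContinuousLinearMap.mul ℝ ℝ).lpPairing μ ∞ 1 q g
        = ∫ x, q x * g x ∂μ := fun g => by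
      rw [ContinuousLinearMap.lpPairing_eq_integral]; rfl
    rw [← hpair]
    change Fc g = _
    -- Both sides are continuous and linear on `L¹`, so agreement on indicators suffices.
    induction g using Lp.induction ENNReal.one_ne_top with
    | @indicatorConst c s hs hμs =>
      rw [Lp.simpleFunc.coe_indicatorConst, hpair]
      refine (hind c hs).trans ?_
      rw [← integral_indicator hs, ← integral_const_mul]
      refine integral_congr_ae ?_
      filter_upwards [hqp, indicatorConstLp_coeFn (p := 1) (hs := hs) (hμs := hμs.ne)
        (c := c)] with x h hx
      rw [hx, h]
      by_cases hxs : x ∈ s <;> simp [hxs, mul_comm]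
    | add hf hg _ h1 h2 => rw [map_add, map_add, h1, h2]
    | isClosed => exact isClosed_eq Fc.continuous (ContinuousLinearMap.continuous _)

/-- **Hahn-Banach** for a functional that is dominated along a linear map into `L¹`. -/
theorem exists_mem_Icc_repr_comp [IsFiniteMeasure μ] {V : Type*} [AddCommGroup V] [Module ℝ V]
    {lo hi : α → ℝ} (hlo : Measurable lo)
    (hhi : Measurable hi) (hlo1 : ∀ x, |lo x| ≤ 1) (hhi1 : ∀ x, |hi x| ≤ 1)
    (hlh : ∀ x, lo x ≤ hi x) (G : V →ₗ[ℝ] Lp ℝ 1 μ) (L : V →ₗ[ℝ] ℝ)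
    (hL : ∀ v, L v ≤ ∫ x, max (lo x * G v x) (hi x * G v x) ∂μ) :
    ∃ q : Lp ℝ ∞ μ, (∀ᵐ x ∂μ, q x ∈ Icc (lo x) (hi x)) ∧
      ∀ v, L v = ∫ x, q x * G v x ∂μ := by
  -- The bound vanishes when `G v = 0`; applied to `v` and `-v` it forces `L v = 0`, so `L` descends
  -- to a functional `f` on the range of `G`.
  have hker : ∀ v, G v = 0 → L v ≤ 0 := fun v hv => by
    refine (hL v).trans_eq (integral_eq_zero_of_ae ?_)
    filter_upwards [Lp.coeFn_zero ℝ 1 μ] with x hx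
    rw [hv, hx]; simp
  have hker' : LinearMap.ker G ≤ LinearMap.ker L := fun v hv => by
    rw [LinearMap.mem_ker] at hv ⊢
    have h2 := hker (-v) (by rw [map_neg, hv, neg_zero])
    rw [map_neg] at h2
    exact le_antisymm (hker v hv) (by linarith)
  let f : LinearMap.range G →ₗ[ℝ] ℝ :=
    ((LinearMap.ker G).liftQ L hker').comp G.quotKerEquivRange.symm.toLinearMap
  have hf : ∀ v, f ⟨G v, v, rfl⟩ = L v := fun v => by
    have : G.quotKerEquivRange.symm ⟨G v, v, rfl⟩ = (LinearMap.ker G).mkQ v := by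
      rw [LinearEquiv.symm_apply_eq]; rfl
    simp [f, this]
  have hint := fun g : Lp ℝ 1 μ =>
    integrable_max_mul hlo hhi hlo1 hhi1 (L1.integrable_coeFn g)
  obtain ⟨F, hF1, hF2⟩ := exists_extension_of_le_sublinear ⟨LinearMap.range G, f⟩
    (fun g : Lp ℝ 1 μ => ∫ x, max (lo x * g x) (hi x * g x) ∂μ)
    (fun c hc g => by
      rw [← integral_const_mul]
      refine integral_congr_ae ?_
      filter_upwards [Lp.coeFn_smul c g] with x hx
      rw [hx, Pi.smul_apply, smul_eq_mul, mul_max_of_nonneg _ _ hc.le]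
      ring_nf)
    (fun g h => by
      rw [← integral_add (hint g) (hint h)]
      refine integral_mono_ae (hint _) ((hint g).add (hint h)) ?_
      filter_upwards [Lp.coeFn_add g h] with x hx
      rw [hx, Pi.add_apply, mul_add, mul_add]
      exact max_add_add_le_max_add_max)
    (by
      rintro ⟨_, v, rfl⟩
      exact (hf v).trans_le (hL v))
  obtain ⟨q, hq, hq'⟩ := exists_mem_Icc_repr hlo hhi hlo1 hhi1 hlh F hF2
  refine ⟨q, hq, fun v => ?_⟩
  rw [← hq', ← hf]
  exact (hF1 ⟨G v, v, rfl⟩).symm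

end Duality

/-! ### One-sided derivative of the integrated absolute value -/

section DirectionalDerivative

variable {α : Type*} [MeasurableSpace α] {μ : Measure α}

/-- The least element of `setSign r`. -/
noncomputable def lowerSign (r : ℝ) : ℝ := if 0 < r then 1 else -1

/-- The greatest element of `setSign r`. -/
noncomputable def upperSign (r : ℝ) : ℝ := if r < 0 then -1 else 1

theorem measurable_lowerSign : Measurable lowerSign :=
  Measurable.ite measurableSet_Ioi measurable_const measurable_const

theorem measurable_upperSign : Measurable upperSign :=
  Measurable.ite measurableSet_Iio measurable_const measurable_const

theorem abs_lowerSign_le (r : ℝ) : |lowerSign r| ≤ 1 := by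
  unfold lowerSign; split_ifs <;> simp

theorem abs_upperSign_le (r : ℝ) : |upperSign r| ≤ 1 := by
  unfold upperSign; split_ifs <;> simp

theorem lowerSign_le_upperSign (r : ℝ) : lowerSign r ≤ upperSign r := by
  unfold lowerSign upperSign; split_ifs <;> linarith

/-- Turns membership in the set-valued sign into the measurable two-sided bounds used by the duality
lemmas. -/
theorem setSign_eq_Icc (r : ℝ) : setSign r = Icc (lowerSign r) (upperSign r) := by
  unfold setSign lowerSign upperSign
  split_ifs with h1 h2
  · linarith
  · simp
  · simp
  · rfl

/-- The one-sided derivative of `s ↦ |a + s b + s² c|` at `0`. -/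
theorem tendsto_abs_quotient (a b c : ℝ) :
    Tendsto (fun s : ℝ => s⁻¹ * (|a + s * b + s ^ 2 * c| - |a|)) (𝓝[>] 0)
      (𝓝 (max (lowerSign a * b) (upperSign a * b))) := by
  have hpos : ∀ᶠ s : ℝ in 𝓝[>] 0, 0 < s := self_mem_nhdsWithin
  have hcont : Tendsto (fun s : ℝ => a + s * b + s ^ 2 * c) (𝓝[>] 0) (𝓝 a) := by
    have : Continuous fun s : ℝ => a + s * b + s ^ 2 * c := by fun_prop
    simpa using (this.tendsto 0).mono_left nhdsWithin_le_nhds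
  have hlin : Tendsto (fun s : ℝ => b + s * c) (𝓝[>] 0) (𝓝 b) := by
    have : Continuous fun s : ℝ => b + s * c := by fun_prop
    simpa using (this.tendsto 0).mono_left nhdsWithin_le_nhds
  -- For `a ≠ 0` the sign is constant for small `s`; for `a = 0` a factor `s` comes out of the
  -- absolute value, leaving `|b + s * c|`.
  rcases lt_trichotomy a 0 with ha | rfl | ha
  · have : max (lowerSign a * b) (upperSign a * b) = -b := by
      simp [lowerSign, upperSign, ha, ha.le.not_gt]
    rw [this]
    refine hlin.neg.congr' ?_
    filter_upwards [hpos, hcont.eventually_lt_const ha] with s hs h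
    rw [abs_of_neg h, abs_of_neg ha]
    field_simp
    ring
  · have : max (lowerSign 0 * b) (upperSign 0 * b) = |b| := by
      simp [lowerSign, upperSign, abs_eq_max_neg, max_comm]
    rw [this]
    refine hlin.abs.congr' ?_
    filter_upwards [hpos] with s hs
    rw [show (0 : ℝ) + s * b + s ^ 2 * c = s * (b + s * c) by ring, abs_mul, abs_of_pos hs]
    field_simp
    simp
  · have : max (lowerSign a * b) (upperSign a * b) = b := by
      simp [lowerSign, upperSign, ha, ha.le.not_gt]
    rw [this]
    refine hlin.congr' ?_
    filter_upwards [hpos, hcont.eventually_const_lt ha] with s hs h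
    rw [abs_of_pos h, abs_of_pos ha]
    field_simp
    ring

/-- Dominated convergence: by the reverse triangle inequality the quotients are at most `|g| + |h|`
for `0 < s ≤ 1`. -/
theorem tendsto_integral_abs_quotient {f g h : α → ℝ} (hf : Integrable f μ) (hg : Integrable g μ)
    (hh : Integrable h μ) :
    Tendsto (fun s : ℝ => s⁻¹ * ((∫ x, |f x + s * g x + s ^ 2 * h x| ∂μ) - ∫ x, |f x| ∂μ))
      (𝓝[>] 0)
      (𝓝 (∫ x, max (lowerSign (f x) * g x) (upperSign (f x) * g x) ∂μ)) := by
  have hi : ∀ s : ℝ, Integrable (fun x => |f x + s * g x + s ^ 2 * h x|) μ := fun s =>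
    ((hf.add (hg.const_mul s)).add (hh.const_mul (s ^ 2))).abs
  have heq : ∀ s : ℝ, s⁻¹ * ((∫ x, |f x + s * g x + s ^ 2 * h x| ∂μ) - ∫ x, |f x| ∂μ)
      = ∫ x, s⁻¹ * (|f x + s * g x + s ^ 2 * h x| - |f x|) ∂μ := fun s => by
    rw [integral_const_mul, integral_sub (hi s) hf.abs]
  simp_rw [heq]
  refine tendsto_integral_filter_of_dominated_convergence (fun x => |g x| + |h x|)
    (.of_forall fun s => (((hi s).sub hf.abs).const_mul _).1) ?_ (hg.abs.add hh.abs)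
    (.of_forall fun x => tendsto_abs_quotient _ _ _)
  filter_upwards [Ioc_mem_nhdsGT (zero_lt_one' ℝ)] with s hs
  refine .of_forall fun x => ?_
  rw [Real.norm_eq_abs, abs_mul, abs_inv, abs_of_pos hs.1, inv_mul_le_iff₀ hs.1]
  refine (abs_abs_sub_abs_le _ _).trans ?_
  rw [show f x + s * g x + s ^ 2 * h x - f x = s * (g x + s * h x) by ring, abs_mul,
    abs_of_pos hs.1]
  refine mul_le_mul_of_nonneg_left ((abs_add_le _ _).trans ?_) hs.1.le
  rw [abs_mul, abs_of_pos hs.1]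
  have := mul_le_of_le_one_left (abs_nonneg (h x)) hs.2
  linarith

end DirectionalDerivative

/-! ### First-order condition for an abstract control space -/

section Optimality

variable {T : ℝ}

theorem coeFn_swapComponents (u : ControlL2 T) :
    ∀ᵐ t ∂timeMeasure T, swapComponents u t 0 = u t 1 ∧ swapComponents u t 1 = u t 0 := by
  filter_upwards [ContinuousLinearMap.coeFn_compLp
    ((LinearIsometryEquiv.piLpCongrLeft 2 ℝ ℝ
      (Equiv.swap (0 : Fin 2) 1)).toContinuousLinearEquiv :
        EuclideanSpace ℝ (Fin 2) →L[ℝ] EuclideanSpace ℝ (Fin 2)) u] with t ht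
  unfold swapComponents
  rw [ht]
  simp [LinearIsometryEquiv.piLpCongrLeft_apply, Equiv.piCongrLeft']

theorem memLp_component (u : ControlL2 T) (i : Fin 2) :
    MemLp (fun t => u t i) 2 (timeMeasure T) :=
  (EuclideanSpace.proj (𝕜 := ℝ) i).comp_memLp' (Lp.memLp u)

theorem integrable_component_mul (u v : ControlL2 T) (i j : Fin 2) :
    Integrable (fun t => u t i * v t j) (timeMeasure T) :=
  (memLp_component u i).integrable_mul (memLp_component v j)

/-- The map `v ↦ u₂ v₁ + u₁ v₂` from `L²(0,T;ℝ²)` to `L¹(0,T)`. -/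
noncomputable def productDeriv (u : ControlL2 T) : ControlL2 T →L[ℝ] Lp ℝ 1 (timeMeasure T) :=
  (innerSL ℝ).holderL (timeMeasure T) 2 2 1 (swapComponents u)

theorem coeFn_productDeriv (u v : ControlL2 T) :
    productDeriv u v =ᵐ[timeMeasure T] fun t => inner ℝ (swapComponents u t) (v t) :=
  ContinuousLinearMap.coeFn_holder (r := 1) (innerSL ℝ) (swapComponents u) v

theorem coeFn_productDeriv_components (u v : ControlL2 T) :
    productDeriv u v =ᵐ[timeMeasure T] fun t => u t 1 * v t 0 + u t 0 * v t 1 := by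
  filter_upwards [coeFn_productDeriv u v, coeFn_swapComponents u] with t h1 h2
  rw [h1, PiLp.inner_apply, Fin.sum_univ_two, h2.1, h2.2]
  simp [mul_comm]

/-- The one-sided directional derivative of the switching penalty. -/
theorem tendsto_switchingPenalty_quotient (u v : ControlL2 T) :
    Tendsto (fun s : ℝ => s⁻¹ * (switchingPenalty (u + s • v) - switchingPenalty u)) (𝓝[>] 0)
      (𝓝 (∫ t, max (lowerSign (u t 0 * u t 1) * productDeriv u v t)
        (upperSign (u t 0 * u t 1) * productDeriv u v t) ∂timeMeasure T)) := by
  -- The product of the components of `u + s • v` is `u₁u₂ + s (u₂v₁ + u₁v₂) + s² v₁v₂`.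
  refine (tendsto_integral_abs_quotient (integrable_component_mul u u 0 1)
    (L1.integrable_coeFn (productDeriv u v)) (integrable_component_mul v v 0 1)).congr fun s => ?_
  congr 2
  refine integral_congr_ae ?_
  filter_upwards [coeFn_productDeriv_components u v, Lp.coeFn_add u (s • v),
    Lp.coeFn_smul s v] with t h1 h2 h3
  rw [h1, h2, Pi.add_apply, h3]
  simp only [Pi.smul_apply, PiLp.add_apply, PiLp.smul_apply, smul_eq_mul]
  ring_nf

theorem l2Functional_smul_swapComponents {U : Type*} [NormedAddCommGroup U] [NormedSpace ℝ U]
    (j : U →L[ℝ] ControlL2 T) (q : Lp ℝ ∞ (timeMeasure T)) (u : ControlL2 T) (v : U) :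
    l2Functional j (q • swapComponents u) v
      = ∫ t, q t * productDeriv u (j v) t ∂timeMeasure T := by
  change inner ℝ (q • swapComponents u : ControlL2 T) (j v) = _
  rw [L2.inner_def]
  refine integral_congr_ae ?_
  filter_upwards [coeFn_productDeriv u (j v),
    Lp.coeFn_lpSMul (r := 2) q (swapComponents u)] with t h1 h2
  rw [h1, h2, Pi.smul_apply', real_inner_smul_left]

/-- First-order condition for a differentiable functional plus the switching penalty. -/
theorem exists_sign_of_isLocalMin {U : Type*} [NormedAddCommGroup U] [NormedSpace ℝ U]
    (j : U →L[ℝ] ControlL2 T) {A : U → ℝ} {A' : StrongDual ℝ U} {u : U} {β : ℝ} (hβ : 0 < β)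
    (hA : HasFDerivAt A A' u)
    (hmin : IsLocalMin (fun v => A v + β * switchingPenalty (j v)) u) :
    ∃ q ∈ signProduct (j u), 0 = A' + β • l2Functional j (q • swapComponents (j u)) := by
  have hmeas : Measurable fun t => j u t 0 * j u t 1 := by
    have h : Measurable (j u) := (Lp.stronglyMeasurable (j u)).measurable
    exact ((EuclideanSpace.proj (𝕜 := ℝ) (0 : Fin 2)).continuous.measurable.comp h).mul
      ((EuclideanSpace.proj (𝕜 := ℝ) (1 : Fin 2)).continuous.measurable.comp h)
  have hdir : ∀ v, 0 ≤ A' v + β * ∫ t, max (lowerSign (j u t 0 * j u t 1) *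
      productDeriv (j u) (j v) t) (upperSign (j u t 0 * j u t 1) *
        productDeriv (j u) (j v) t) ∂timeMeasure T := by
    intro v
    have hA1 : Tendsto (fun s : ℝ => s⁻¹ * (A (u + s • v) - A u)) (𝓝[>] 0) (𝓝 (A' v)) := by
      have := (hA.hasLineDerivAt v).tendsto_slope_zero_right
      simpa using this
    have hlim := hA1.add ((tendsto_switchingPenalty_quotient (j u) (j v)).const_mul β)
    refine ge_of_tendsto hlim ?_
    have hline : Tendsto (fun s : ℝ => u + s • v) (𝓝[>] 0) (𝓝 u) := by
      have : Continuous fun s : ℝ => u + s • v := by fun_prop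
      simpa using (this.tendsto 0).mono_left nhdsWithin_le_nhds
    filter_upwards [hline.eventually hmin, self_mem_nhdsWithin] with s hs hpos
    rw [map_add, map_smul] at hs
    have := mul_nonneg (inv_nonneg.2 (mem_Ioi.1 hpos).le) (sub_nonneg.2 hs)
    refine this.trans_eq ?_
    ring
  -- Dividing `hdir` by `β` gives exactly the domination of `-β⁻¹ • A'`.
  obtain ⟨q, hq, hq'⟩ := exists_mem_Icc_repr_comp (μ := timeMeasure T)
    (measurable_lowerSign.comp hmeas)
    (measurable_upperSign.comp hmeas) (fun _ => abs_lowerSign_le _) (fun _ => abs_upperSign_le _)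
    (fun _ => lowerSign_le_upperSign _)
    ((productDeriv (j u)).comp j).toLinearMap ((-β⁻¹ • A').toLinearMap) (fun v => by
      have := mul_nonneg (inv_nonneg.2 hβ.le) (hdir v)
      rw [mul_add, inv_mul_cancel_left₀ hβ.ne'] at this
      simp only [ContinuousLinearMap.coe_coe, ContinuousLinearMap.comp_apply,
        Function.comp_apply, smul_apply, smul_eq_mul]
      linarith)
  refine ⟨q, ?_, ?_⟩
  · filter_upwards [hq] with t ht
    rw [setSign_eq_Icc]
    exact ht
  · ext v
    have h := hq' v
    simp only [ContinuousLinearMap.coe_coe, ContinuousLinearMap.comp_apply,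
      smul_apply, smul_eq_mul] at h
    rw [add_apply, smul_apply,
      l2Functional_smul_swapComponents, ← h]
    simp [hβ.ne']

end Optimality

/-! ### Derivatives of the smooth terms -/

section Problem

variable {T : ℝ} {n : ℕ} {Ω : Set (EuclideanSpace ℝ (Fin n))} (ω : Set (EuclideanSpace ℝ (Fin n)))
variable {W : Type*} [NormedAddCommGroup W] [InnerProductSpace ℝ W]
variable (ι : W →L[ℝ] StateL2 T Ω) (S : ControlL2 T →ᴬ[ℝ] W) (yd : ObsL2 T Ω ω)
variable {U : Type*} [NormedAddCommGroup U] [NormedSpace ℝ U] (j : U →L[ℝ] ControlL2 T)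

theorem hasFDerivAt_residual (u : ControlL2 T) :
    HasFDerivAt (residual ω ι S yd) (linearObsOp ω ι S) u := by
  have hS : HasFDerivAt S S.contLinear u := by
    have : (S : ControlL2 T → W) = fun v => S.contLinear v + S 0 := by
      exact ContinuousAffineMap.decomp S
    rw [this]
    exact S.contLinear.hasFDerivAt.add_const _
  exact (((observe T Ω ω).hasFDerivAt.comp u (ι.hasFDerivAt.comp u hS))).sub_const yd

theorem hasFDerivAt_tracking (u : U) :
    HasFDerivAt (fun v => 1 / 2 * ‖residual ω ι S yd (j v)‖ ^ 2)
      (l2Functional j (adjointResidual ω ι S yd (j u))) u := by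
  have h := (((hasFDerivAt_residual ω ι S yd (j u)).comp u j.hasFDerivAt).norm_sq).const_mul
    (1 / 2)
  refine h.congr_fderiv ?_
  ext v
  simp [l2Functional, adjointResidual, ContinuousLinearMap.adjoint_inner_left]

theorem hasFDerivAt_half_norm_sq {H : Type*} [NormedAddCommGroup H] [InnerProductSpace ℝ H]
    (k : U →L[ℝ] H) (c : ℝ) (u : U) :
    HasFDerivAt (fun v => c / 2 * ‖k v‖ ^ 2) (c • (innerSL ℝ (k u)).comp k) u := by
  refine (k.hasFDerivAt.norm_sq.const_mul (c / 2)).congr_fderiv ?_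
  ext v
  simp
  ring

end Problem

end SwitchingControl

theorem theorem3p1 {T : ℝ} (hT : 0 < T) {n : ℕ}
    (Ω ω : Set (EuclideanSpace ℝ (Fin n))) (hΩ : MeasurableSet Ω) (hω : MeasurableSet ω)
    (hωΩ : ω ⊆ Ω)
    {W : Type*} [NormedAddCommGroup W] [InnerProductSpace ℝ W] [CompleteSpace W]
    (ι : W →L[ℝ] SwitchingControl.StateL2 T Ω) (hι : Function.Injective ι)
    (S : SwitchingControl.ControlL2 T →ᴬ[ℝ] W) (yd : SwitchingControl.ObsL2 T Ω ω)
    (α β : ℝ) (hα : 0 < α) (hαβ : α < β) :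
    (∀ ε : ℝ, 0 < ε → ∀ u : SwitchingControl.H1 T,
      IsLocalMin (SwitchingControl.costH1 ω ι S yd α β ε) u →
        0 ∈ SwitchingControl.optimalitySetH1 ω ι S yd α β ε u) ∧
    (∀ U : Submodule ℝ (SwitchingControl.ControlL2 T), FiniteDimensional ℝ U → ∀ u : U,
      IsLocalMin (SwitchingControl.costSubspace ω ι S yd α β U) u →
        0 ∈ SwitchingControl.optimalitySetSubspace ω ι S yd α β U u) := by
  have hβ : 0 < β := hα.trans hαβ
  refine ⟨fun ε _ u hu => ?_, fun U _ u hu => ?_⟩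
  -- The cost and the optimality set unfold definitionally to the abstract form, the derivatives
  -- matching term by term.
  · exact SwitchingControl.exists_sign_of_isLocalMin (SwitchingControl.H1.toL2 T) hβ
      (((SwitchingControl.hasFDerivAt_tracking ω ι S yd (SwitchingControl.H1.toL2 T) u).add
        (SwitchingControl.hasFDerivAt_half_norm_sq (SwitchingControl.H1.toL2 T) α u)).add
        (SwitchingControl.hasFDerivAt_half_norm_sq (SwitchingControl.H1.weakDeriv T) ε u)) hu
  · exact SwitchingControl.exists_sign_of_isLocalMin U.subtypeL hβ
      ((SwitchingControl.hasFDerivAt_tracking ω ι S yd U.subtypeL u).add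
        (SwitchingControl.hasFDerivAt_half_norm_sq U.subtypeL α u)) hu
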